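/- Setting. Let $n\ge 1$, let $\beta\in[0,1]$ with $\beta n\in\mathbb{Z}$, and let $S\in[0,1]^{(1+\beta)n\times n}$ be a similarity matrix whose rows are indexed by a set $\mathcal R$ of $(1+\beta)n$ reviewers and whose columns are indexed by a set $\mathcal P$ of $n$ papers. For $\mathcal R'\subseteq\mathcal R$ and $\mathcal P'\subseteq\mathcal P$ let $\mathcal M(\mathcal R',\mathcal P')$ be the set of matrices $A\in\{0,1\}^{\mathcal R\times\mathcal P}$ with $\sum_{r\in\mathcal R'}A_{rp}=1$ for all $p\in\mathcal P'$, $\sum_{p\in\mathcal P'}A_{rp}\le 1$ for all $r\in\mathcal R'$, and $A_{rp}=0$ for $(r,p)\notin\mathcal R'\times\mathcal P'$. For $\mathcal P_2\subseteq\mathcal P$ and $\mathcal R_2\subseteq\mathcal R$ with $|\mathcal P_2|=|\mathcal R_2|=\beta n$ put $$Q^*(\mathcal P_2)=\frac{1}{(1+\beta)n}\max_{A,B}\Big[\sum_{r\in\mathcal R,\,p\in\mathcal P}A_{rp}S_{rp}+\sum_{r\in\mathcal R,\,p\in\mathcal P_2}B_{rp}S_{rp}\Big],$$ the maximum being over $A\in\mathcal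 M(\mathcal R,\mathcal P)$ and $B\in\mathcal M(\mathcal R,\mathcal P_2)$ with $\sum_{p\in\mathcal P}(A_{rp}+B_{rp})\le1$ for all $r\in\mathcal R$, and $$Q(\mathcal R_2,\mathcal P_2)=\frac{1}{(1+\beta)n}\Big[\max_{A\in\mathcal M(\mathcal R\setminus\mathcal R_2,\mathcal P)}\sum_{r\in\mathcal R\setminus\mathcal R_2,\,p\in\mathcal P}A_{rp}S_{rp}+\max_{B\in\mathcal M(\mathcal R_2,\mathcal P_2)}\sum_{r\in\mathcal R_2,\,p\in\mathcal P_2}B_{rp}S_{rp}\Big].$$ The suboptimality of random split is the random variable $Q^*(\mathcal P_2)-Q(\mathcal R_2,\mathcal P_2)$, where $\mathcal R_2$ and $\mathcal P_2$ are independent and uniformly distributed over the subsets of size $\beta n$ of $\mathcal R$ and of $\mathcal P$, respectively. Theorem 3. For every integer $k\ge1$ there are constants $C,\eta$ depending only on $k$ such that for every constant $\beta\in[0,1]$ there is $n_0$ such that, for every $n\ge n_0$ with $\beta n\in\mathbb{Z}$ and every similarity matrix $S\in[0,1]^{(1+\beta)n\times n}$ of rank $k$, with probability at least $1-\frac1n$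 the suboptimality of random split is at most - $C(\log n)^{\eta}\,n^{-1/2}$ if $k=1$; - $C(\log n)^{\eta}\,n^{-1/2+1/\log\log n}$ if $k=2$; - $C(\log n)^{\eta}\,n^{-1/k+1/\log\log n}$ if $k\ge3$, where $\log$ is the base-$2$ logarithm. -/

import Mathlib

namespace TwoStage

/-- The valid assignment matrices `A : R × P → {0, 1}` of the reviewers in `R'` to the papers in
`P'`: every paper in `P'` gets exactly `lpap` reviewers from `R'`, every reviewer in `R'` gets at
most `lrev` papers from `P'`, and nothing is assigned outside `R' × P'`. -/
def validAssignments {R P : Type} (R' : Finset R) (P' : Finset P) (lrev lpap : ℕ) :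
    Set (Matrix R P ℕ) :=
  {A | (∀ r p, A r p = 0 ∨ A r p = 1) ∧
    (∀ p ∈ P', ∑ r ∈ R', A r p = lpap) ∧
    (∀ r ∈ R', ∑ p ∈ P', A r p ≤ lrev) ∧
    (∀ r p, ¬ (r ∈ R' ∧ p ∈ P') → A r p = 0)}

/-- Total similarity `∑ A r p * S r p` over `r ∈ R'`, `p ∈ P'`. -/
noncomputable def totalSim {R P : Type} (S : Matrix R P ℝ) (R' : Finset R) (P' : Finset P)
    (A : Matrix R P ℕ) : ℝ :=
  ∑ r ∈ R', ∑ p ∈ P', (A r p : ℝ) * S r p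

/-- Maximum total similarity of an assignment of reviewers `R'` to papers `P'`, unit loads
(the supremum is over a finite set, nonempty as soon as `|P'| ≤ |R'|`). -/
noncomputable def maxSim {R P : Type} (S : Matrix R P ℝ) (R' : Finset R) (P' : Finset P) : ℝ :=
  sSup {v | ∃ A ∈ validAssignments R' P' 1 1, v = totalSim S R' P' A}

/-- Mean similarity of the oracle optimal assignment given the second-stage papers `P₂`
(all papers are in stage one, and all loads are `1`). The supremum is over a finite set, nonempty
as soon as there are at least `|P| + |P₂|` reviewers. -/
noncomputable def oracleQ {R P : Type} [Fintype R] [Fintype P] (S : Matrix R P ℝ)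
    (P₂ : Finset P) : ℝ :=
  (1 / ((Fintype.card P : ℝ) + (P₂.card : ℝ))) *
    sSup {v | ∃ A ∈ validAssignments (Finset.univ : Finset R) (Finset.univ : Finset P) 1 1,
      ∃ B ∈ validAssignments (Finset.univ : Finset R) P₂ 1 1,
        (∀ r, ∑ p, (A r p + B r p) ≤ 1) ∧
        v = totalSim S Finset.univ Finset.univ A + totalSim S Finset.univ P₂ B}

/-- Mean similarity of the optimal assignment when reviewers `R₂` and papers `P₂` are in the second
stage: the other reviewers are assigned to all papers in stage one, and `R₂` to `P₂` in stage
two (all loads are `1`). -/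
noncomputable def splitQ {R P : Type} [Fintype R] [Fintype P] [DecidableEq R] (S : Matrix R P ℝ)
    (R₂ : Finset R) (P₂ : Finset P) : ℝ :=
  (1 / ((Fintype.card P : ℝ) + (P₂.card : ℝ))) *
    (maxSim S (Finset.univ \ R₂) Finset.univ + maxSim S R₂ P₂)

/-- Suboptimality of the second-stage reviewer set `R₂` when the second-stage papers are `P₂`. -/
noncomputable def suboptimality {R P : Type} [Fintype R] [Fintype P] [DecidableEq R]
    (S : Matrix R P ℝ) (R₂ : Finset R) (P₂ : Finset P) : ℝ :=
  oracleQ S P₂ - splitQ S R₂ P₂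

open Classical in
/-- Probability of the event `E R₂ P₂` when `R₂` and `P₂` are independent and uniformly distributed
over the `m`-element subsets of `R` and of `P`, respectively. -/
noncomputable def randomSplitProb (R P : Type) [Fintype R] [Fintype P] (m : ℕ)
    (E : Finset R → Finset P → Prop) : ℝ :=
  ((((Finset.univ : Finset R).powersetCard m ×ˢ (Finset.univ : Finset P).powersetCard m).filter
      (fun x => E x.1 x.2)).card : ℝ) /
    (((Finset.univ : Finset R).powersetCard m ×ˢ (Finset.univ : Finset P).powersetCard m).card : ℝ)

end TwoStage

/-!
Why the random split loses little. An oracle assignment for `P₂` is a bijection from the reviewers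
to the slots, where the papers of `P₂` have a second, stage-two slot. A split `R₂` is feasible once
the reviewers are permuted so that `R₂` takes the place of the set `T` of reviewers that the oracle
uses in stage two (`exists_oracle_slots`). Only the papers of the permuted reviewers matter for the
loss, so it is enough to exchange reviewers of *similar papers*: the loss is a transport cost
between `R₂` and `T`, both placed at the papers that the oracle gives them.

Papers are columns of a rank-`k` matrix. A choice of `k` columns of maximal volume gives every paper
coordinates in `[-1, 1]ᵏ` such that the `ℓ¹` distance bounds the difference of columns
(`exists_column_coordinates`). In dyadic cells of this cube, `P₂` contains about its share `m / n` of
the papers of every cell, and given `P₂`, the independent set `R₂` contains about its share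
`m / (n + m)` of the reviewers whose oracle paper lies in the cell; the two expected numbers coincide
(`abs_sub_le_of_deviations`). By concentration for sampling without replacement
(`card_powersetCard_deviation_le`) and a union bound, all cells with `N` papers have imbalance
`O(√N log n)`. A hierarchical matching (`exists_perm_card_ne_le_imbalance`) then moves, at each
scale, at most as many reviewers across cells as the total imbalance at that scale, which is
`O(√(2 ^ (i k) n) log n)` by Cauchy-Schwarz. Summing over scales down to side `n ^ (-1 / max k 2)`
gives a loss of `O(log² n · n ^ (-1 / max k 2))` per slot, within all three stated bounds.
-/

namespace TwoStage
open Finset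

/-! ### Sampling without replacement -/

/-- The binomial weight `C(N, j) m ^ j d ^ (N - j)` with `N = m + d` is largest at `j = m`. -/
lemma binomial_weight_le_mode (m d j : ℕ) (hj : j ≤ m + d) :
    m ^ j * d ^ (m + d - j) * (m + d).choose j ≤ m ^ m * d ^ d * (m + d).choose m := by
  have step : ∀ i, i + 1 ≤ m + d →
      (m ^ (i + 1) * d ^ (m + d - (i + 1)) * (m + d).choose (i + 1)) * (i + 1) =
        m ^ i * d ^ (m + d - (i + 1)) * (m + d).choose i * (m * (m + d - i)) := by
    intro i _
    rw [mul_assoc, Nat.choose_succ_right_eq]; ring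
  have step' : ∀ i, i + 1 ≤ m + d →
      (m ^ i * d ^ (m + d - i) * (m + d).choose i) * (i + 1) =
        m ^ i * d ^ (m + d - (i + 1)) * (m + d).choose i * ((i + 1) * d) := by
    intro i hi
    rw [show m + d - i = m + d - (i + 1) + 1 by omega]; ring
  have up : ∀ i, i ≤ m → m ^ (m - i) * d ^ (m + d - (m - i)) * (m + d).choose (m - i) ≤
      m ^ m * d ^ d * (m + d).choose m := by
    intro i
    induction i with
    | zero => intro _; simp
    | succ i ih =>
      intro hi
      refine le_trans ?_ (ih (by omega))
      obtain ⟨a, ha⟩ : ∃ a, a = m - (i + 1) := ⟨_, rfl⟩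
      rw [← ha, show m - i = a + 1 by omega]
      refine Nat.le_of_mul_le_mul_right ?_ (Nat.succ_pos a)
      rw [Nat.succ_eq_add_one, step a (by omega), step' a (by omega)]
      gcongr <;> omega
  have down : ∀ i, m + i ≤ m + d →
      m ^ (m + i) * d ^ (m + d - (m + i)) * (m + d).choose (m + i) ≤
      m ^ m * d ^ d * (m + d).choose m := by
    intro i
    induction i with
    | zero => intro _; simp
    | succ i ih =>
      intro hi
      refine le_trans ?_ (ih (by omega))
      rw [← add_assoc]
      refine Nat.le_of_mul_le_mul_right ?_ (Nat.succ_pos (m + i))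
      rw [Nat.succ_eq_add_one, step _ (by omega), step' _ (by omega)]
      gcongr <;> omega
  rcases le_total j m with h | h
  · have := up (m - j) (by omega)
    rwa [show m - (m - j) = j by omega] at this
  · have := down (j - m) (by omega)
    rwa [show m + (j - m) = j by omega] at this

/-- A binomial variable with `N` trials and integral mean `m` equals `m` with probability at least
`1 / (N + 1)`. -/
lemma one_le_mul_binomial_at_mean {N m : ℕ} (hm : m ≤ N) (hN : 0 < N) :
    1 ≤ ((N : ℝ) + 1) * ((N.choose m : ℝ) *
      (((m : ℝ) / N) ^ m * (1 - (m : ℝ) / N) ^ (N - m))) := by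
  obtain ⟨d, rfl⟩ := Nat.exists_eq_add_of_le hm
  have h1 : (m + d) ^ (m + d) ≤ (m + d + 1) * (m ^ m * d ^ d * (m + d).choose m) := by
    rw [add_pow]
    refine (Finset.sum_le_card_nsmul _ _ (m ^ m * d ^ d * (m + d).choose m) ?_).trans ?_
    · intro j hj
      exact binomial_weight_le_mode m d j (by simpa [Nat.lt_succ_iff] using hj)
    · simp
  have h2 : ((m : ℝ) + d) ^ (m + d) ≤
      ((m : ℝ) + d + 1) * ((m : ℝ) ^ m * (d : ℝ) ^ d * ((m + d).choose m : ℝ)) := by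
    exact_mod_cast h1
  have hpos : (0 : ℝ) < (m : ℝ) + d := by exact_mod_cast hN
  have h3 : 1 - (m : ℝ) / ((m : ℝ) + d) = d / ((m : ℝ) + d) := by
    field_simp; ring
  push_cast
  rw [h3, show m + d - m = d by omega, div_pow, div_pow, div_mul_div_comm, ← pow_add,
    ← mul_div_assoc, ← mul_div_assoc, le_div_iff₀ (by positivity)]
  nlinarith [h2]

lemma bernoulli_mgf_le {p t : ℝ} (hp0 : 0 ≤ p) (hp1 : p ≤ 1) (ht : |t| ≤ 1) :
    p * Real.exp (t * (1 - p)) + (1 - p) * Real.exp (-(t * p)) ≤ Real.exp (t ^ 2) := by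
  have h1 : |t * (1 - p)| ≤ 1 := by
    rw [abs_mul, abs_of_nonneg (by linarith : 0 ≤ 1 - p)]
    nlinarith [abs_nonneg t]
  have h2 : |-(t * p)| ≤ 1 := by
    rw [abs_neg, abs_mul, abs_of_nonneg hp0]
    nlinarith [abs_nonneg t]
  have h3 := (abs_le.mp (Real.abs_exp_sub_one_sub_id_le h1)).2
  have h4 := (abs_le.mp (Real.abs_exp_sub_one_sub_id_le h2)).2
  have h5 := Real.add_one_le_exp (t ^ 2)
  have h6 : p * Real.exp (t * (1 - p)) ≤ p * (1 + t * (1 - p) + (t * (1 - p)) ^ 2) :=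
    mul_le_mul_of_nonneg_left (by linarith) hp0
  have h7 : (1 - p) * Real.exp (-(t * p)) ≤ (1 - p) * (1 + -(t * p) + (-(t * p)) ^ 2) :=
    mul_le_mul_of_nonneg_left (by linarith) (by linarith)
  have h8 : t ^ 2 * (p * (1 - p)) ≤ t ^ 2 * 1 :=
    mul_le_mul_of_nonneg_left (by nlinarith) (sq_nonneg t)
  nlinarith

/-- Exponential moment of `|X ∩ Q|` for a uniformly random `m`-subset `X`, centred at its mean.
A uniform `m`-subset is a Bernoulli(`m / N`) subset conditioned on having `m` elements, an event of
probability at least `1 / (N + 1)`. -/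
lemma sum_powersetCard_exp_le {α : Type} [Fintype α] [DecidableEq α] {m : ℕ}
    (hm : m ≤ Fintype.card α) (hN : 0 < Fintype.card α) (Q : Finset α) {t : ℝ} (ht : |t| ≤ 1) :
    ∑ X ∈ (univ : Finset α).powersetCard m,
        Real.exp (t * ((#(X ∩ Q) : ℝ) - #Q * (m / Fintype.card α))) ≤
      ((Fintype.card α : ℝ) + 1) * ((Fintype.card α).choose m : ℝ) *
        Real.exp (t ^ 2 * #Q) := by
  set N := Fintype.card α with hNdef
  set p : ℝ := (m : ℝ) / N with hp
  have hNR : (0 : ℝ) < N := by exact_mod_cast hN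
  have hp0 : 0 ≤ p := by positivity
  have hp1 : p ≤ 1 := by
    rw [hp, div_le_one hNR]; exact_mod_cast hm
  have hq0 : 0 ≤ 1 - p := by linarith
  set w : ℝ := p ^ m * (1 - p) ^ (N - m) with hw
  have hw0 : 0 ≤ w := by positivity
  have hmode : 1 ≤ ((N : ℝ) + 1) * ((N.choose m : ℝ) * w) := one_le_mul_binomial_at_mean hm hN
  have key : w * ∑ X ∈ (univ : Finset α).powersetCard m,
        Real.exp (t * ((#(X ∩ Q) : ℝ) - #Q * p)) ≤ Real.exp (t ^ 2 * #Q) := by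
    have hprod : ∏ a : α, (p * (if a ∈ Q then Real.exp t else 1) + (1 - p)) =
        (p * Real.exp t + (1 - p)) ^ #Q := by
      rw [← Finset.prod_subset (Finset.subset_univ Q)]
      · rw [Finset.prod_congr rfl (g := fun _ => p * Real.exp t + (1 - p)), Finset.prod_const]
        intro a ha; simp [ha]
      · intro a _ ha; simp [ha]
    have hterm : ∀ X ∈ (univ : Finset α).powersetCard m,
        w * Real.exp (t * ((#(X ∩ Q) : ℝ) - #Q * p)) =
          Real.exp (-(t * p)) ^ #Q * ((∏ a ∈ X, p * (if a ∈ Q then Real.exp t else 1)) *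
            ∏ _a ∈ univ \ X, (1 - p)) := by
      intro X hX
      have hc : #X = m := (Finset.mem_powersetCard.mp hX).2
      rw [Finset.prod_mul_distrib, Finset.prod_const, Finset.prod_const, hc,
        Finset.card_sdiff_of_subset (Finset.subset_univ X), Finset.card_univ, hc,
        ← Finset.prod_filter, Finset.prod_const, Finset.filter_mem_eq_inter,
        ← Real.exp_nat_mul, ← Real.exp_nat_mul]
      rw [show t * ((#(X ∩ Q) : ℝ) - #Q * p) = #Q * -(t * p) + #(X ∩ Q) * t by ring, Real.exp_add]
      ring
    rw [Finset.mul_sum, Finset.sum_congr rfl hterm, ← Finset.mul_sum]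
    calc _ ≤ Real.exp (-(t * p)) ^ #Q * ∑ X ∈ (univ : Finset α).powerset,
            ((∏ a ∈ X, p * (if a ∈ Q then Real.exp t else 1)) * ∏ _a ∈ univ \ X, (1 - p)) := by
          refine mul_le_mul_of_nonneg_left ?_ (by positivity)
          refine Finset.sum_le_sum_of_subset_of_nonneg ?_ ?_
          · intro X _; simp
          · intro X _ _
            refine mul_nonneg (Finset.prod_nonneg fun a _ => mul_nonneg hp0 ?_)
              (Finset.prod_nonneg fun _ _ => hq0)
            split_ifs <;> positivity
      _ = (p * Real.exp (t * (1 - p)) + (1 - p) * Real.exp (-(t * p))) ^ #Q := by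
          rw [← Finset.prod_add, hprod, ← mul_pow, mul_add]
          rw [show t * (1 - p) = -(t * p) + t by ring, Real.exp_add]
          congr 1; ring
      _ ≤ Real.exp (t ^ 2) ^ #Q := by
          refine pow_le_pow_left₀ (by positivity) (bernoulli_mgf_le hp0 hp1 ht) _
      _ = _ := by rw [← Real.exp_nat_mul]; ring_nf
  set W := ∑ X ∈ (univ : Finset α).powersetCard m,
        Real.exp (t * ((#(X ∩ Q) : ℝ) - #Q * p))
  have hS : 0 ≤ W := Finset.sum_nonneg fun _ _ => (Real.exp_pos _).le
  calc W ≤ (((N : ℝ) + 1) * ((N.choose m : ℝ) * w)) * W := le_mul_of_one_le_left hS hmode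
    _ = ((N : ℝ) + 1) * (N.choose m : ℝ) * (w * W) := by ring
    _ ≤ _ := mul_le_mul_of_nonneg_left key (by positivity)

/-- Concentration for sampling without replacement. The exponent is only linear in `s` because the
exponential moment is used at `t = ±1 / √|Q|`, where a second-order expansion is enough. -/
lemma card_powersetCard_deviation_le {α : Type} [Fintype α] [DecidableEq α] {m : ℕ}
    (hm : m ≤ Fintype.card α) (hN : 0 < Fintype.card α) (Q : Finset α) (s : ℝ) :
    (#{X ∈ (univ : Finset α).powersetCard m |
        s * √(#Q) < |(#(X ∩ Q) : ℝ) - #Q * (m / Fintype.card α)|} : ℝ) ≤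
      6 * ((Fintype.card α : ℝ) + 1) * ((Fintype.card α).choose m : ℝ) * Real.exp (-s) := by
  rcases Finset.eq_empty_or_nonempty Q with rfl | hQ
  · simp; positivity
  have hq : (1 : ℝ) ≤ #Q := by exact_mod_cast hQ.card_pos
  have hsq : 1 ≤ √(#Q : ℝ) := Real.one_le_sqrt.mpr hq
  set u : ℝ := 1 / √(#Q : ℝ) with hu
  have hu0 : 0 ≤ u := by positivity
  have hu1 : |u| ≤ 1 := by
    rw [abs_of_nonneg hu0, hu, div_le_one (by linarith)]; exact hsq
  have huQ : u ^ 2 * #Q = 1 := by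
    rw [hu, div_pow, Real.sq_sqrt (by linarith)]; field_simp
  have husq : u * √(#Q : ℝ) = 1 := by rw [hu]; field_simp
  have hplus := sum_powersetCard_exp_le hm hN Q hu1
  have hminus := sum_powersetCard_exp_le hm hN Q (t := -u) (by rwa [abs_neg])
  rw [neg_sq] at hminus
  rw [huQ] at hplus hminus
  set c : ℝ := ((Fintype.card α : ℝ) + 1) * ((Fintype.card α).choose m : ℝ) with hc
  have hc0 : 0 ≤ c := by positivity
  have hmarkov : (#{X ∈ (univ : Finset α).powersetCard m |
        s * √(#Q) < |(#(X ∩ Q) : ℝ) - #Q * (m / Fintype.card α)|} : ℝ) * Real.exp s ≤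
      2 * (c * Real.exp 1) := by
    rw [← nsmul_eq_mul]
    have hsum := add_le_add hplus hminus
    rw [← Finset.sum_add_distrib] at hsum
    rw [two_mul]
    refine le_trans (le_trans (Finset.card_nsmul_le_sum _ (fun X =>
      Real.exp (u * ((#(X ∩ Q) : ℝ) - #Q * (m / Fintype.card α))) +
      Real.exp (-u * ((#(X ∩ Q) : ℝ) - #Q * (m / Fintype.card α)))) _ ?_)
      (Finset.sum_le_sum_of_subset_of_nonneg (Finset.filter_subset _ _) ?_)) hsum
    · intro X hX
      have hX2 := (Finset.mem_filter.mp hX).2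
      set y := (#(X ∩ Q) : ℝ) - #Q * (m / Fintype.card α)
      have h1 : s ≤ u * |y| := by
        calc s = u * (s * √(#Q : ℝ)) := by rw [mul_left_comm, husq, mul_one]
          _ ≤ _ := mul_le_mul_of_nonneg_left hX2.le hu0
      rcases abs_cases y with ⟨h, _⟩ | ⟨h, _⟩ <;> rw [h] at h1
      · exact (Real.exp_le_exp.mpr h1).trans (le_add_of_nonneg_right (Real.exp_pos _).le)
      · rw [mul_neg, ← neg_mul] at h1
        exact (Real.exp_le_exp.mpr h1).trans (le_add_of_nonneg_left (Real.exp_pos _).le)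
    · intro X _ _; positivity
  have he : Real.exp 1 ≤ 3 := by linarith [Real.exp_one_lt_d9]
  rw [Real.exp_neg, ← div_eq_mul_inv, le_div_iff₀ (Real.exp_pos _)]
  refine hmarkov.trans ?_
  nlinarith [mul_le_mul_of_nonneg_left he hc0]

/-! ### Hierarchical matching -/

section Swap
variable {R κ : Type} [Fintype R] [DecidableEq κ]

/-- Total imbalance between `X` and `Y` over the colour classes of `c`. -/
def imbalance (c : R → κ) (X Y : Finset R) : ℤ :=
  ∑ Q ∈ univ.image c, |(#{r ∈ X | c r = Q} : ℤ) - #{r ∈ Y | c r = Q}|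

lemma imbalance_nonneg (c : R → κ) (X Y : Finset R) : 0 ≤ imbalance c X Y :=
  Finset.sum_nonneg fun _ _ => abs_nonneg _

lemma sum_card_colour_class (c : R → κ) (X : Finset R) :
    ∑ Q ∈ univ.image c, #{r ∈ X | c r = Q} = #X :=
  (Finset.card_eq_sum_card_fiberwise fun r _ => by simp).symm

variable [DecidableEq R]

/-- If no colour class meets both `X \ Y` and `Y \ X`, the imbalance is as large as possible. -/
lemma imbalance_eq_of_forall_ne {c : R → κ} {X Y : Finset R} (hXY : #X = #Y)
    (h : ∀ a ∈ X \ Y, ∀ b ∈ Y \ X, c a ≠ c b) : imbalance c X Y = 2 * #(X \ Y) := by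
  have hcomm : #(X \ Y) = #(Y \ X) := Finset.card_sdiff_comm hXY
  have hsplit : ∀ (A B : Finset R) (Q : κ),
      #{r ∈ A | c r = Q} = #{r ∈ A \ B | c r = Q} + #{r ∈ A ∩ B | c r = Q} := by
    intro A B Q
    rw [← Finset.card_union_of_disjoint, ← Finset.filter_union, Finset.sdiff_union_inter]
    exact Finset.disjoint_filter_filter (Finset.disjoint_sdiff_inter A B)
  have hterm : ∀ Q : κ, |(#{r ∈ X | c r = Q} : ℤ) - #{r ∈ Y | c r = Q}| =
      (#{r ∈ X \ Y | c r = Q} : ℤ) + #{r ∈ Y \ X | c r = Q} := by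
    intro Q
    rw [hsplit X Y Q, hsplit Y X Q, Finset.inter_comm Y X]
    rcases Finset.eq_empty_or_nonempty {r ∈ X \ Y | c r = Q} with h0 | ⟨a, ha⟩
    · rw [h0]; simp
    · have h0 : {r ∈ Y \ X | c r = Q} = ∅ := by
        rw [Finset.filter_eq_empty_iff]
        intro b hb hbQ
        rw [Finset.mem_filter] at ha
        exact h a ha.1 b hb (ha.2.trans hbQ.symm)
      rw [h0]; simp
  unfold imbalance
  rw [Finset.sum_congr rfl fun Q _ => hterm Q, Finset.sum_add_distrib]
  have h1 := sum_card_colour_class c (X \ Y)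
  have h2 := sum_card_colour_class c (Y \ X)
  rw [← hcomm] at h2
  zify at h1 h2
  rw [h1, h2]; ring

lemma imbalance_map_swap {c : R → κ} {X Y : Finset R} {a b : R} (hab : c a = c b) :
    imbalance c X (Y.map (Equiv.swap a b).toEmbedding) = imbalance c X Y := by
  have hc : ∀ r, c (Equiv.swap a b r) = c r := by
    intro r
    by_cases h1 : r = a
    · subst h1; rw [Equiv.swap_apply_left]; exact hab.symm
    · by_cases h2 : r = b
      · subst h2; rw [Equiv.swap_apply_right]; exact hab
      · rw [Equiv.swap_apply_of_ne_of_ne h1 h2]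
  unfold imbalance
  refine Finset.sum_congr rfl fun Q _ => ?_
  rw [Finset.filter_map, Finset.card_map]
  simp only [Function.comp_def, Equiv.coe_toEmbedding, hc]

/-- Hierarchical matching: for nested colourings `c 0, …, c J` (finer as the index grows), the set
`X` can be permuted onto `Y` so that, at every level, the number of points that change colour is at
most the imbalance at that level. Pairs that agree down to the finest possible level are swapped
first: such a swap preserves the imbalance at the levels where the pair agrees, and below them no
colour class contains both points of `X \ Y` and of `Y \ X`. -/
lemma exists_perm_card_ne_le_imbalance (J : ℕ) (c : ℕ → R → κ)
    (hc : ∀ i j r r', i ≤ j → c j r = c j r' → c i r = c i r') (X Y : Finset R) (hXY : #X = #Y) :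
    ∃ σ : Equiv.Perm R, (∀ r, r ∈ X ↔ σ r ∈ Y) ∧
      ∀ i ≤ J, (#{r | c i r ≠ c i (σ r)} : ℤ) ≤ imbalance (c i) X Y := by
  suffices H : ∀ (s : ℕ) (Y : Finset R), #X = #Y → #(X \ Y) = s →
      ∃ σ : Equiv.Perm R, (∀ r, r ∈ X ↔ σ r ∈ Y) ∧ #{r | σ r ≠ r} ≤ 2 * s ∧
        ∀ i ≤ J, (#{r | c i r ≠ c i (σ r)} : ℤ) ≤ imbalance (c i) X Y by
    obtain ⟨σ, h1, -, h2⟩ := H _ Y hXY rfl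
    exact ⟨σ, h1, h2⟩
  intro s
  induction s with
  | zero =>
    intro Y hXY hs
    have hsub : X ⊆ Y := Finset.sdiff_eq_empty_iff_subset.mp (Finset.card_eq_zero.mp hs)
    have : X = Y := Finset.eq_of_subset_of_card_le hsub hXY.ge
    subst this
    exact ⟨1, by simp, by simp, fun i _ => by simpa using imbalance_nonneg _ _ _⟩
  | succ s ih =>
    intro Y hXY hs
    have hne1 : (X \ Y).Nonempty := Finset.card_pos.mp (by omega)
    have hne2 : (Y \ X).Nonempty := Finset.card_pos.mp (by
      rw [← Finset.card_sdiff_comm hXY]; omega)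
    obtain ⟨⟨a, b⟩, hmem, hmax⟩ := Finset.exists_max_image ((X \ Y) ×ˢ (Y \ X))
      (fun q => #{l ∈ range (J + 1) | c l q.1 = c l q.2}) (hne1.product hne2)
    obtain ⟨ha, hb⟩ := Finset.mem_product.mp hmem
    simp only [] at ha hb
    have halt : ∀ i ≤ J, c i a ≠ c i b → ∀ a' ∈ X \ Y, ∀ b' ∈ Y \ X, c i a' ≠ c i b' := by
      intro i hi hab a' ha' b' hb' hab'
      have h1 := hmax (a', b') (Finset.mem_product.mpr ⟨ha', hb'⟩)
      have h2 : range (i + 1) ⊆ {l ∈ range (J + 1) | c l a' = c l b'} := by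
        intro l hl
        rw [Finset.mem_range] at hl
        rw [Finset.mem_filter, Finset.mem_range]
        exact ⟨by omega, hc l i _ _ (by omega) hab'⟩
      have h3 : {l ∈ range (J + 1) | c l a = c l b} ⊆ range i := by
        intro l hl
        rw [Finset.mem_filter, Finset.mem_range] at hl
        rw [Finset.mem_range]
        by_contra hcon
        exact hab (hc i l _ _ (by omega) hl.2)
      have h4 := Finset.card_le_card h2
      have h5 := Finset.card_le_card h3
      rw [Finset.card_range] at h4 h5
      simp only [] at h1
      omega
    rw [Finset.mem_sdiff] at ha hb
    set τ := Equiv.swap a b with hτ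
    set Y' := Y.map τ.toEmbedding with hY'
    have hmemY' : ∀ r, r ∈ Y' ↔ τ r ∈ Y := by
      intro r
      rw [hY', Finset.mem_map_equiv, hτ, Equiv.symm_swap]
    have hXY' : X \ Y' = (X \ Y).erase a := by
      ext r
      rw [Finset.mem_sdiff, Finset.mem_erase, Finset.mem_sdiff, hmemY']
      by_cases h1 : r = a
      · subst h1; simp [hτ, hb.1]
      · by_cases h2 : r = b
        · subst h2; simp [hb.2]
        · rw [hτ, Equiv.swap_apply_of_ne_of_ne h1 h2]; simp [h1]
    obtain ⟨σ, hσ1, hσ2, hσ3⟩ := ih Y' (by rw [hY', Finset.card_map, hXY]) (by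
      rw [hXY', Finset.card_erase_of_mem (Finset.mem_sdiff.mpr ha), hs]; rfl)
    have hmoved : #{r | (σ.trans τ) r ≠ r} ≤ 2 * (s + 1) := by
      have hsub : ({r | (σ.trans τ) r ≠ r} : Finset R) ⊆
          ({r | σ r ≠ r} : Finset R) ∪ {a, b} := by
        intro r hr
        replace hr : τ (σ r) ≠ r := (Finset.mem_filter.mp hr).2
        simp only [Finset.mem_union, Finset.mem_filter, Finset.mem_univ, true_and,
          Finset.mem_insert, Finset.mem_singleton]
        by_contra hcon
        push Not at hcon
        obtain ⟨h1, h2, h3⟩ := hcon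
        rw [h1, hτ, Equiv.swap_apply_of_ne_of_ne h2 h3] at hr
        exact hr rfl
      refine (Finset.card_le_card hsub).trans ((Finset.card_union_le _ _).trans ?_)
      have := Finset.card_le_two (a := a) (b := b)
      omega
    refine ⟨σ.trans τ, fun r => ?_, hmoved, fun i hi => ?_⟩
    · rw [hσ1, hmemY']; rfl
    · by_cases hab : c i a = c i b
      · have h1 := hσ3 i hi
        rw [hY', hτ, imbalance_map_swap hab] at h1
        refine le_trans (le_of_eq ?_) h1
        congr 2
        ext r
        rw [Finset.mem_filter, Finset.mem_filter, Equiv.trans_apply, hτ]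
        by_cases h1 : σ r = a
        · rw [h1, Equiv.swap_apply_left, hab]
        · by_cases h2 : σ r = b
          · rw [h2, Equiv.swap_apply_right, hab]
          · rw [Equiv.swap_apply_of_ne_of_ne h1 h2]
      · rw [imbalance_eq_of_forall_ne hXY (halt i hi hab), hs]
        have hsub : ({r | c i r ≠ c i ((σ.trans τ) r)} : Finset R) ⊆
            ({r | (σ.trans τ) r ≠ r} : Finset R) := by
          intro r hr
          rw [Finset.mem_filter] at hr ⊢
          exact ⟨hr.1, fun h => hr.2 (by rw [h])⟩
        exact_mod_cast (Finset.card_le_card hsub).trans hmoved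

end Swap

/-! ### Coordinates and dyadic cells -/

/-- A spanning finite family contains a basis with respect to which all members have coordinates in
`[-1, 1]`: by Cramer's rule, any sub-basis of maximal volume will do. -/
lemma exists_basis_abs_repr_le_one {P V : Type} [Fintype P] [AddCommGroup V] [Module ℝ V]
    {k : ℕ} (v : P → V) (hspan : Submodule.span ℝ (Set.range v) = ⊤)
    (hk : Module.finrank ℝ (Submodule.span ℝ (Set.range v)) = k) :
    ∃ (e : Fin k → P) (x : P → Fin k → ℝ), (∀ p t, |x p t| ≤ 1) ∧
      ∀ p, v p = ∑ t, x p t • v (e t) := by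
  classical
  have : FiniteDimensional ℝ V := by
    refine ⟨⟨(Set.finite_range v).toFinset, ?_⟩⟩
    rw [Set.Finite.coe_toFinset]; exact hspan
  have h := Submodule.exists_fun_fin_finrank_span_eq ℝ (Set.range v)
  rw [hk] at h
  obtain ⟨f, hf, hfs, hfl⟩ := h
  choose e₀ he₀ using hf
  rw [hspan] at hfs
  let b : Module.Basis (Fin k) ℝ V := Module.Basis.mk hfl hfs.ge
  have hb : ∀ t, b t = v (e₀ t) := fun t => by simp [b, he₀]
  have : Nonempty (Fin k → P) := ⟨e₀⟩
  obtain ⟨e, he⟩ := Finite.exists_max fun e : Fin k → P => |b.det (v ∘ e)|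
  have hdet : b.det (v ∘ e) ≠ 0 := by
    have h1 := he e₀
    rw [show v ∘ e₀ = b from funext fun t => (hb t).symm, b.det_self, abs_one] at h1
    intro h0
    rw [h0, abs_zero] at h1
    linarith
  obtain ⟨hli, hsp⟩ := (Module.Basis.is_basis_iff_det b).mpr (isUnit_iff_ne_zero.mpr hdet)
  let b' : Module.Basis (Fin k) ℝ V := Module.Basis.mk hli hsp.ge
  refine ⟨e, fun p t => b'.repr (v p) t, fun p t => ?_, fun p => ?_⟩
  · have h1 := congrArg (fun g => g (v p)) (b.det_smul_mk_coord_eq_det_update hli hsp.ge t)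
    simp only [LinearMap.smul_apply, smul_eq_mul, MultilinearMap.toLinearMap_apply,
      AlternatingMap.coe_multilinearMap] at h1
    change b.det (v ∘ e) * b'.repr (v p) t = _ at h1
    rw [← Function.comp_update] at h1
    have h2 := he (Function.update e t p)
    rw [← h1, abs_mul] at h2
    exact le_of_mul_le_mul_left (h2.trans_eq (mul_one _).symm) (abs_pos.mpr hdet)
  · conv_lhs => rw [← b'.sum_repr (v p)]
    simp [b']

/-- The columns of a rank-`k` matrix are combinations, with coefficients in `[-1, 1]`, of `k` of
them. -/
lemma exists_column_coordinates {R P : Type} [Fintype R] [Fintype P] {k : ℕ} (S : Matrix R P ℝ)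
    (hS : S.rank = k) :
    ∃ (e : Fin k → P) (x : P → Fin k → ℝ), (∀ p t, |x p t| ≤ 1) ∧
      ∀ r p, S r p = ∑ t, x p t * S r (e t) := by
  rw [Matrix.rank_eq_finrank_span_cols] at hS
  let v : P → Submodule.span ℝ (Set.range S.col) := fun p =>
    ⟨S.col p, Submodule.subset_span ⟨p, rfl⟩⟩
  have hspan : Submodule.span ℝ (Set.range v) = ⊤ := by
    have := Submodule.span_span_coe_preimage (R := ℝ) (s := Set.range S.col)
    rw [← this]
    congr 1
    ext ⟨y, hy⟩
    simp [v]
  obtain ⟨e, x, hx, hv⟩ := exists_basis_abs_repr_le_one v hspan (by rw [hspan, finrank_top, hS])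
  refine ⟨e, x, hx, fun r p => ?_⟩
  have h1 := congrArg (fun w : Submodule.span ℝ (Set.range S.col) => (w : R → ℝ) r) (hv p)
  simpa [v, Matrix.col_apply] using h1

/-- The dyadic cell of side `4 / 2 ^ i` containing `x ∈ [-1, 1]ᵏ`. The rescaling by `1 / 4` puts
`x` into `[0, 1/2]ᵏ`, so that level `0` has one cell only. -/
noncomputable def dyadicCell {k : ℕ} (i : ℕ) (x : Fin k → ℝ) : Fin k → ℕ :=
  fun t => ⌊(x t + 1) / 4 * 2 ^ i⌋₊

lemma dyadicCell_eq_of_le {k : ℕ} {i j : ℕ} (hij : i ≤ j) {x y : Fin k → ℝ}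
    (h : dyadicCell j x = dyadicCell j y) : dyadicCell i x = dyadicCell i y := by
  have key : ∀ z : Fin k → ℝ, ∀ t, dyadicCell i z t = dyadicCell j z t / 2 ^ (j - i) := by
    intro z t
    unfold dyadicCell
    rw [← Nat.floor_div_natCast]
    congr 1
    obtain ⟨d, rfl⟩ := Nat.exists_eq_add_of_le hij
    push_cast
    rw [show i + d - i = d by omega, pow_add]
    field_simp
  funext t
  rw [key, key, h]

lemma dyadicCell_lt {k : ℕ} (i : ℕ) {x : Fin k → ℝ} (hx : ∀ t, |x t| ≤ 1) (t : Fin k) :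
    dyadicCell i x t < 2 ^ i := by
  unfold dyadicCell
  obtain ⟨h1, h2⟩ := abs_le.mp (hx t)
  have hp : (0 : ℝ) < 2 ^ i := by positivity
  rw [Nat.floor_lt (mul_nonneg (by linarith) hp.le)]
  push_cast
  nlinarith

lemma abs_sub_le_of_dyadicCell_eq {k : ℕ} {i : ℕ} {x y : Fin k → ℝ} (hx : ∀ t, |x t| ≤ 1)
    (hy : ∀ t, |y t| ≤ 1) (h : dyadicCell i x = dyadicCell i y) (t : Fin k) :
    |x t - y t| ≤ 4 / 2 ^ i := by
  have h1 := congrFun h t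
  unfold dyadicCell at h1
  have hp : (0 : ℝ) < 2 ^ i := by positivity
  have hxt := abs_le.mp (hx t)
  have hyt := abs_le.mp (hy t)
  have a1 := Nat.floor_le (a := (x t + 1) / 4 * 2 ^ i) (mul_nonneg (by linarith) hp.le)
  have a2 := Nat.lt_floor_add_one ((x t + 1) / 4 * 2 ^ i)
  have b1 := Nat.floor_le (a := (y t + 1) / 4 * 2 ^ i) (mul_nonneg (by linarith) hp.le)
  have b2 := Nat.lt_floor_add_one ((y t + 1) / 4 * 2 ^ i)
  rw [h1] at a1 a2
  rw [abs_le, ← neg_div, div_le_iff₀ hp, le_div_iff₀ hp]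
  constructor <;> nlinarith

lemma card_image_dyadicCell_le {P : Type} [Fintype P] {k : ℕ} (i : ℕ) {x : P → Fin k → ℝ}
    (hx : ∀ p t, |x p t| ≤ 1) :
    #(univ.image fun p => dyadicCell i (x p)) ≤ 2 ^ (i * k) := by
  have hsub : (univ.image fun p => dyadicCell i (x p)) ⊆
      Fintype.piFinset fun _ : Fin k => range (2 ^ i) := by
    intro Q hQ
    obtain ⟨p, -, rfl⟩ := Finset.mem_image.mp hQ
    rw [Fintype.mem_piFinset]
    exact fun t => Finset.mem_range.mpr (dyadicCell_lt i (hx p) t)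
  refine (Finset.card_le_card hsub).trans (le_of_eq ?_)
  rw [Fintype.card_piFinset_const, Finset.card_range, ← pow_mul]

/-! ### Permuting the oracle assignment -/

section Assignments
variable {R P : Type} [DecidableEq R] [DecidableEq P]

/-- The assignment matrix in which each reviewer `r ∈ T` gets the paper `ψ r` and all other
reviewers get nothing. -/
def assignmentOf (T : Finset R) (ψ : R → P) : Matrix R P ℕ :=
  fun r p => if r ∈ T ∧ ψ r = p then 1 else 0

lemma assignmentOf_mem_validAssignments {R' T : Finset R} {P' : Finset P} {ψ : R → P}
    (hT : T ⊆ R') (hψ : ∀ r ∈ T, ψ r ∈ P') (hcount : ∀ p ∈ P', #{r ∈ T | ψ r = p} = 1) :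
    assignmentOf T ψ ∈ validAssignments R' P' 1 1 := by
  refine ⟨fun r p => ?_, fun p hp => ?_, fun r _ => ?_, fun r p h => ?_⟩
  · unfold assignmentOf; split_ifs <;> simp
  · unfold assignmentOf
    rw [← Finset.card_filter, ← hcount p hp]
    congr 1
    ext r
    simp only [Finset.mem_filter]
    exact ⟨fun h => h.2, fun h => ⟨hT h.1, h⟩⟩
  · unfold assignmentOf
    rw [← Finset.card_filter]
    refine Finset.card_le_one.mpr fun p hp q hq => ?_
    rw [← (Finset.mem_filter.mp hp).2.2, ← (Finset.mem_filter.mp hq).2.2]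
  · unfold assignmentOf
    refine if_neg fun hr => h ⟨hT hr.1, ?_⟩
    rw [← hr.2]; exact hψ r hr.1

lemma totalSim_assignmentOf (S : Matrix R P ℝ) {R' T : Finset R} {P' : Finset P} {ψ : R → P}
    (hT : T ⊆ R') (hψ : ∀ r ∈ T, ψ r ∈ P') :
    totalSim S R' P' (assignmentOf T ψ) = ∑ r ∈ T, S r (ψ r) := by
  unfold totalSim assignmentOf
  rw [← Finset.sum_subset hT]
  · refine Finset.sum_congr rfl fun r hr => ?_
    rw [Finset.sum_eq_single_of_mem (ψ r) (hψ r hr)]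
    · simp [hr]
    · intro p _ hp; simp [hp.symm]
  · intro r _ hr
    exact Finset.sum_eq_zero fun p _ => by simp [hr]

lemma sum_le_maxSim {S : Matrix R P ℝ} (hS : ∀ r p, 0 ≤ S r p) {R' : Finset R} {P' : Finset P}
    {ψ : R → P} (hψ : ∀ r ∈ R', ψ r ∈ P') (hcount : ∀ p ∈ P', #{r ∈ R' | ψ r = p} = 1) :
    ∑ r ∈ R', S r (ψ r) ≤ maxSim S R' P' := by
  refine le_csSup ⟨∑ r ∈ R', ∑ p ∈ P', S r p, ?_⟩
    ⟨_, assignmentOf_mem_validAssignments (le_refl R') hψ hcount,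
      (totalSim_assignmentOf S (le_refl R') hψ).symm⟩
  rintro _ ⟨A, hA, rfl⟩
  refine Finset.sum_le_sum fun r _ => Finset.sum_le_sum fun p _ => ?_
  rcases hA.1 r p with h | h <;> simp [h, hS r p]

lemma finite_validAssignments [Fintype R] [Fintype P] (R' : Finset R) (P' : Finset P) :
    (validAssignments R' P' 1 1).Finite := by
  refine Set.Finite.subset (Set.finite_Icc (0 : R → P → ℕ) 1) fun A hA => ⟨fun r p => ?_, fun r p => ?_⟩
  · exact Nat.zero_le _
  · show A r p ≤ 1
    rcases hA.1 r p with h | h <;> omega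

/-- If the reviewers are exactly as many as the slots, a feasible pair of assignments for the two
stages is given by one map from reviewers to papers and the set of reviewers used in stage two. -/
lemma exists_eq_assignmentOf [Fintype R] [Fintype P] {P₂ : Finset P}
    (hcard : Fintype.card R = Fintype.card P + #P₂) {A B : Matrix R P ℕ}
    (hA : A ∈ validAssignments (univ : Finset R) (univ : Finset P) 1 1)
    (hB : B ∈ validAssignments (univ : Finset R) P₂ 1 1)
    (hAB : ∀ r, ∑ p, (A r p + B r p) ≤ 1) :
    ∃ (T : Finset R) (φ : R → P), A = assignmentOf (univ \ T) φ ∧ B = assignmentOf T φ := by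
  have hsumA : ∑ r, ∑ p, A r p = Fintype.card P := by
    rw [Finset.sum_comm (f := fun r p => A r p),
      Finset.sum_congr rfl fun p _ => hA.2.1 p (Finset.mem_univ p)]
    simp
  have hsumB : ∑ r, ∑ p, B r p = #P₂ := by
    rw [Finset.sum_comm (f := fun r p => B r p), ← Finset.sum_subset (Finset.subset_univ P₂),
      Finset.sum_congr rfl fun p hp => hB.2.1 p hp]
    · simp
    · intro p _ hp
      exact Finset.sum_eq_zero fun r _ => hB.2.2.2 r p fun h => hp h.2
  have hrow : ∀ r, ∑ p, (A r p + B r p) = 1 := by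
    have h := (Finset.sum_eq_sum_iff_of_le (s := univ) (f := fun r => ∑ p, (A r p + B r p))
      (g := fun _ => 1) fun r _ => hAB r).mp (by
        simp only [Finset.sum_add_distrib, hsumA, hsumB]; simp [hcard])
    exact fun r => h r (Finset.mem_univ r)
  have hex : ∀ r, ∃ p, A r p + B r p ≠ 0 := by
    intro r
    obtain ⟨p, -, hp⟩ := Finset.exists_ne_zero_of_sum_ne_zero (by rw [hrow r]; exact one_ne_zero)
    exact ⟨p, hp⟩
  choose φ hφ using hex
  have hoff : ∀ r p, φ r ≠ p → A r p + B r p = 0 := by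
    intro r p hp
    have h1 := Finset.add_le_sum (s := univ) (f := fun p => A r p + B r p)
      (fun _ _ => Nat.zero_le _) (Finset.mem_univ (φ r)) (Finset.mem_univ p) hp
    rw [hrow r] at h1
    have := hφ r
    omega
  have hon : ∀ r, A r (φ r) + B r (φ r) ≤ 1 := fun r => by
    rw [← hrow r]
    exact Finset.single_le_sum (f := fun p => A r p + B r p) (fun _ _ => Nat.zero_le _)
      (Finset.mem_univ (φ r))
  refine ⟨univ.filter fun r => B r (φ r) = 1, φ, ?_, ?_⟩
  · ext r p
    unfold assignmentOf
    by_cases hp : φ r = p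
    · subst hp
      have h1 := hon r
      have h2 := hφ r
      by_cases h : B r (φ r) = 1
      · simp [h]; omega
      · simp [h]; omega
    · have := hoff r p hp
      simp [hp]; omega
  · ext r p
    unfold assignmentOf
    by_cases hp : φ r = p
    · subst hp
      have h1 := hon r
      by_cases h : B r (φ r) = 1
      · simp [h]
      · simp [h]; omega
    · have := hoff r p hp
      simp [hp]; omega

end Assignments

lemma card_filter_comp_perm {R P : Type} [Fintype R] [DecidableEq P] {T R₂ : Finset R} (φ : R → P) (σ : Equiv.Perm R)
    (hσ : ∀ r, r ∈ R₂ ↔ σ r ∈ T) (p : P) :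
    #{r ∈ R₂ | φ (σ r) = p} = #{r ∈ T | φ r = p} := by
  rw [← Finset.card_map σ.toEmbedding]
  congr 1
  ext r
  simp [Finset.mem_map_equiv, hσ]

/-- The oracle assignment for `P₂` is a bijection from the reviewers to the slots: `φ r` is the
paper of `r`, and `T` is the set of reviewers used in stage two. Permuting the reviewers so that
`R₂` takes the place of `T` costs at most the similarity lost by the reviewers who move. -/
lemma exists_oracle_slots {R P : Type} [Fintype R] [Fintype P] [DecidableEq R] [DecidableEq P]
    [Nonempty P] {S : Matrix R P ℝ} (hS : ∀ r p, 0 ≤ S r p) {P₂ : Finset P}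
    (hcard : Fintype.card R = Fintype.card P + #P₂) :
    ∃ (T : Finset R) (φ : R → P), (∀ p, #{r ∈ univ \ T | φ r = p} = 1) ∧
      (∀ p, #{r ∈ T | φ r = p} = if p ∈ P₂ then 1 else 0) ∧
      ∀ (R₂ : Finset R) (σ : Equiv.Perm R), (∀ r, r ∈ R₂ ↔ σ r ∈ T) →
        suboptimality S R₂ P₂ ≤
          1 / (Fintype.card P : ℝ) * ∑ r, |S r (φ r) - S r (φ (σ r))| := by
  set V : Set ℝ := {v | ∃ A ∈ validAssignments (univ : Finset R) (univ : Finset P) 1 1,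
      ∃ B ∈ validAssignments (univ : Finset R) P₂ 1 1,
        (∀ r, ∑ p, (A r p + B r p) ≤ 1) ∧
        v = totalSim S univ univ A + totalSim S univ P₂ B} with hV
  have hfin : V.Finite := by
    refine Set.Finite.subset (Set.Finite.image2
      (fun A B => totalSim S univ univ A + totalSim S univ P₂ B)
      (finite_validAssignments (univ : Finset R) (univ : Finset P))
      (finite_validAssignments (univ : Finset R) P₂)) ?_
    rintro _ ⟨A, hA, B, hB, -, rfl⟩
    exact Set.mem_image2_of_mem hA hB
  have hne : V.Nonempty := by
    have e : R ≃ P ⊕ P₂ := Fintype.equivOfCardEq (by simp [hcard])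
    let φ : R → P := fun r => Sum.elim id Subtype.val (e r)
    let T : Finset R := {r | (e r).isRight}
    refine ⟨_, assignmentOf (univ \ T) φ,
      assignmentOf_mem_validAssignments (Finset.subset_univ _) (fun _ _ => Finset.mem_univ _) ?_,
      assignmentOf T φ, assignmentOf_mem_validAssignments (Finset.subset_univ _) ?_ ?_, ?_, rfl⟩
    · intro p _
      rw [Finset.card_eq_one]
      refine ⟨e.symm (Sum.inl p), ?_⟩
      ext r
      rw [Finset.mem_singleton, Equiv.eq_symm_apply]
      rcases h : e r with q | q <;> simp [T, φ, h]
    · intro r hr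
      rcases h : e r with q | q
      · simp [T, h] at hr
      · simp [φ, h]
    · intro p hp
      rw [Finset.card_eq_one]
      refine ⟨e.symm (Sum.inr ⟨p, hp⟩), ?_⟩
      ext r
      rw [Finset.mem_singleton, Equiv.eq_symm_apply]
      rcases h : e r with q | q <;> simp [T, φ, h, Subtype.ext_iff]
    · intro r
      unfold assignmentOf
      by_cases h : r ∈ T <;> simp [h]
  obtain ⟨A, hA, B, hB, hAB, hsup⟩ := hne.csSup_mem hfin
  obtain ⟨T, φ, rfl, rfl⟩ := exists_eq_assignmentOf hcard hA hB hAB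
  have hφT : ∀ r ∈ T, φ r ∈ P₂ := by
    intro r hr
    by_contra hcon
    have := hB.2.2.2 r (φ r) fun h => hcon h.2
    simp [assignmentOf, hr] at this
  have hcount : ∀ (T' : Finset R) (p : P),
      ∑ r, assignmentOf T' φ r p = #{r ∈ T' | φ r = p} := by
    intro T' p
    unfold assignmentOf
    rw [← Finset.card_filter]
    congr 1
    ext r; simp
  have hcA : ∀ p, #{r ∈ univ \ T | φ r = p} = 1 := fun p => by
    rw [← hcount]; exact hA.2.1 p (Finset.mem_univ p)
  have hcB : ∀ p ∈ P₂, #{r ∈ T | φ r = p} = 1 := fun p hp => by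
    rw [← hcount]; exact hB.2.1 p hp
  refine ⟨T, φ, hcA, fun p => ?_, fun R₂ σ hσ => ?_⟩
  · split_ifs with hp
    · exact hcB p hp
    · rw [Finset.card_eq_zero, Finset.filter_eq_empty_iff]
      rintro r hr rfl
      exact hp (hφT r hr)
  have hσ' : ∀ r, r ∈ univ \ R₂ ↔ σ r ∈ univ \ T := by simp [hσ]
  have h1 : ∑ r ∈ univ \ R₂, S r (φ (σ r)) ≤ maxSim S (univ \ R₂) univ :=
    sum_le_maxSim hS (fun _ _ => Finset.mem_univ _) fun p _ => by
      rw [card_filter_comp_perm φ σ hσ', hcA]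
  have h2 : ∑ r ∈ R₂, S r (φ (σ r)) ≤ maxSim S R₂ P₂ :=
    sum_le_maxSim hS (fun r hr => hφT _ ((hσ r).mp hr)) fun p hp => by
      rw [card_filter_comp_perm φ σ hσ, hcB p hp]
  rw [totalSim_assignmentOf S (Finset.subset_univ _) fun _ _ => Finset.mem_univ _,
    totalSim_assignmentOf S (Finset.subset_univ _) hφT,
    Finset.sum_sdiff (Finset.subset_univ T)] at hsup
  have h3 : ∑ r ∈ univ \ R₂, S r (φ (σ r)) + ∑ r ∈ R₂, S r (φ (σ r)) = ∑ r, S r (φ (σ r)) :=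
    Finset.sum_sdiff (Finset.subset_univ R₂)
  have h4 : ∑ r, S r (φ r) - ∑ r, S r (φ (σ r)) ≤ ∑ r, |S r (φ r) - S r (φ (σ r))| := by
    rw [← Finset.sum_sub_distrib]
    exact Finset.sum_le_sum fun r _ => le_abs_self _
  have hP : (0 : ℝ) < Fintype.card P := by exact_mod_cast Fintype.card_pos
  have hsplit : suboptimality S R₂ P₂ = 1 / ((Fintype.card P : ℝ) + #P₂) *
      (sSup V - (maxSim S (univ \ R₂) univ + maxSim S R₂ P₂)) := by
    unfold suboptimality oracleQ splitQ
    rw [← hV]; ring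
  rw [hsplit, hsup]
  calc _ ≤ 1 / ((Fintype.card P : ℝ) + #P₂) * ∑ r, |S r (φ r) - S r (φ (σ r))| := by
        refine mul_le_mul_of_nonneg_left (by linarith) (by positivity)
    _ ≤ _ := by
        refine mul_le_mul_of_nonneg_right ?_ (Finset.sum_nonneg fun _ _ => abs_nonneg _)
        exact one_div_le_one_div_of_le hP (le_add_of_nonneg_right (Nat.cast_nonneg _))

/-! ### The loss of a balanced split, and conditioning -/

/-- Chaining through the dyadic scales: two columns cost at most the cell diameter at the finest
scale `J`, plus the parent diameter at each scale where their cells differ. -/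
lemma abs_sub_le_chain {R P : Type} {k : ℕ} {S : Matrix R P ℝ} (hS : ∀ r p, 0 ≤ S r p ∧ S r p ≤ 1)
    {e : Fin k → P} {x : P → Fin k → ℝ} (hx : ∀ p t, |x p t| ≤ 1)
    (hSx : ∀ r p, S r p = ∑ t, x p t * S r (e t)) (J : ℕ) (r : R) (p q : P) :
    |S r p - S r q| ≤ 4 * k * (1 / 2 ^ J + ∑ i ∈ range J, 1 / 2 ^ i *
      if dyadicCell (i + 1) (x p) ≠ dyadicCell (i + 1) (x q) then 1 else 0) := by
  have hagree : ∀ i, dyadicCell i (x p) = dyadicCell i (x q) →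
      |S r p - S r q| ≤ 4 * k * (1 / 2 ^ i) := by
    intro i h
    rw [hSx r p, hSx r q, ← Finset.sum_sub_distrib]
    calc _ ≤ ∑ t, |x p t * S r (e t) - x q t * S r (e t)| := Finset.abs_sum_le_sum_abs _ _
      _ ≤ ∑ _t : Fin k, 4 / 2 ^ i := by
          refine Finset.sum_le_sum fun t _ => ?_
          rw [← sub_mul, abs_mul, abs_of_nonneg (hS r (e t)).1]
          refine (mul_le_of_le_one_right (abs_nonneg _) (hS r (e t)).2).trans ?_
          exact abs_sub_le_of_dyadicCell_eq (hx p) (hx q) h t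
      _ = _ := by simp; ring
  induction J with
  | zero =>
    have h0 : dyadicCell 0 (x p) = dyadicCell 0 (x q) := by
      funext t
      have h1 := dyadicCell_lt 0 (hx p) t
      have h2 := dyadicCell_lt 0 (hx q) t
      rw [pow_zero] at h1 h2
      omega
    simpa using hagree 0 h0
  | succ J ih =>
    by_cases h : dyadicCell (J + 1) (x p) = dyadicCell (J + 1) (x q)
    · refine (hagree (J + 1) h).trans ?_
      refine mul_le_mul_of_nonneg_left (le_add_of_nonneg_right ?_) (by positivity)
      exact Finset.sum_nonneg fun i _ => mul_nonneg (by positivity) (by split_ifs <;> norm_num)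
    · refine ih.trans (mul_le_mul_of_nonneg_left ?_ (by positivity))
      rw [Finset.sum_range_succ, if_pos h, mul_one]
      have : (0 : ℝ) ≤ 1 / 2 ^ (J + 1) := by positivity
      linarith

/-- Let a cell have `N` papers, of which `b` are in stage two, so that the oracle puts `N + b`
reviewers there, and let `R₂` contain `a` of these. If `b` is near `N m / n` and `a` is near
`(N + b) m / (n + m)`, then `a` is near `b`: at `b = N m / n` the two targets coincide. -/
lemma abs_sub_le_of_deviations {a b N n m s : ℝ} (hn : 0 < n) (hm : 0 ≤ m) (hb : 0 ≤ b)
    (hbN : b ≤ N) (hs : 0 ≤ s) (h1 : |a - (N + b) * (m / (n + m))| ≤ s * √(N + b))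
    (h2 : |b - N * (m / n)| ≤ s * √N) : |a - b| ≤ 3 * s * √N := by
  have hid : a - b = (a - (N + b) * (m / (n + m))) - n / (n + m) * (b - N * (m / n)) := by
    field_simp; ring
  have hfrac : n / (n + m) ≤ 1 := by
    rw [div_le_one (by linarith)]; linarith
  have hsq : √(N + b) ≤ 2 * √N := by
    rw [show (2 : ℝ) = √4 by rw [show (4 : ℝ) = 2 ^ 2 by norm_num, Real.sqrt_sq (by norm_num)],
      ← Real.sqrt_mul (by norm_num)]
    exact Real.sqrt_le_sqrt (by linarith)
  rw [hid]
  refine (abs_sub _ _).trans ?_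
  have h3 : |n / (n + m) * (b - N * (m / n))| ≤ s * √N := by
    rw [abs_mul, abs_of_nonneg (by positivity)]
    exact (mul_le_of_le_one_left (abs_nonneg _) hfrac).trans h2
  have h4 := mul_le_mul_of_nonneg_left hsq hs
  linarith

lemma sum_sqrt_card_fiber_le {P κ : Type} [Fintype P] [DecidableEq κ] (c : P → κ) :
    ∑ Q ∈ univ.image c, √(#{p | c p = Q} : ℝ) ≤ √(#(univ.image c) * Fintype.card P) := by
  have h := Real.sum_sqrt_mul_sqrt_le (univ.image c) (f := fun _ => (1 : ℝ))
    (g := fun Q => (#{p | c p = Q} : ℝ)) (fun _ => by norm_num) (fun _ => Nat.cast_nonneg _)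
  simp only [Real.sqrt_one, one_mul] at h
  refine h.trans (le_of_eq ?_)
  rw [← Nat.cast_sum, sum_card_colour_class c univ, ← Real.sqrt_mul (by positivity)]
  simp

section Deterministic
variable {R P : Type} [Fintype R] [Fintype P] [DecidableEq R] [DecidableEq P]

/-- The papers in the same dyadic cell of level `i` as `p`. -/
noncomputable def cellmates {k : ℕ} (x : P → Fin k → ℝ) (i : ℕ) (p : P) : Finset P :=
  {q | dyadicCell i (x q) = dyadicCell i (x p)}

/-- When `P₂` meets every cell in about its share of papers and `R₂` meets the set of reviewers
that the oracle puts on every cell in about its share, the random split is nearly optimal. -/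
lemma exists_oracle_suboptimality_le [Nonempty P] {k : ℕ} {S : Matrix R P ℝ}
    (hS : ∀ r p, 0 ≤ S r p ∧ S r p ≤ 1) {e : Fin k → P} {x : P → Fin k → ℝ}
    (hx : ∀ p t, |x p t| ≤ 1) (hSx : ∀ r p, S r p = ∑ t, x p t * S r (e t)) {P₂ : Finset P}
    (hcard : Fintype.card R = Fintype.card P + #P₂) (J : ℕ) {s : ℝ} (hs : 0 ≤ s)
    (hP₂ : ∀ i ∈ range J, ∀ p, |(#(P₂ ∩ cellmates x (i + 1) p) : ℝ) -
      #(cellmates x (i + 1) p) * (#P₂ / Fintype.card P)| ≤ s * √(#(cellmates x (i + 1) p))) :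
    ∃ φ : R → P, ∀ R₂ : Finset R, #R₂ = #P₂ →
      (∀ i ∈ range J, ∀ p, |(#(R₂ ∩ univ.filter fun r => φ r ∈ cellmates x (i + 1) p) : ℝ) -
        #{r | φ r ∈ cellmates x (i + 1) p} * (#P₂ / Fintype.card R)| ≤
          s * √(#{r | φ r ∈ cellmates x (i + 1) p})) →
      suboptimality S R₂ P₂ ≤ 1 / (Fintype.card P : ℝ) * (4 * k *
        (2 * Fintype.card P / 2 ^ J + ∑ i ∈ range J, 1 / 2 ^ i *
          (3 * s * √(2 ^ ((i + 1) * k) * Fintype.card P)))) := by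
  obtain ⟨T, φ, hT1, hT2, hsub⟩ := exists_oracle_slots (fun r p => (hS r p).1) hcard
  have hP : (0 : ℝ) < Fintype.card P := by exact_mod_cast Fintype.card_pos
  have hfibre1 : ∀ C : Finset P, #{r ∈ univ \ T | φ r ∈ C} = #C := by
    intro C
    rw [Finset.card_eq_sum_card_fiberwise (f := φ) (t := C) (by intro r hr; simpa using
      (Finset.mem_filter.mp (Finset.mem_coe.mp hr)).2), Finset.card_eq_sum_ones]
    refine Finset.sum_congr rfl fun p hp => ?_
    rw [Finset.filter_filter, ← hT1 p]
    congr 1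
    refine Finset.filter_congr fun r _ => ⟨fun h => h.2, fun h => ⟨h ▸ hp, h⟩⟩
  have hfibre2 : ∀ C : Finset P, #{r ∈ T | φ r ∈ C} = #(P₂ ∩ C) := by
    intro C
    rw [Finset.card_eq_sum_card_fiberwise (f := φ) (t := C) (by intro r hr; simpa using
      (Finset.mem_filter.mp (Finset.mem_coe.mp hr)).2), Finset.inter_comm,
      ← Finset.filter_mem_eq_inter, Finset.card_filter]
    refine Finset.sum_congr rfl fun p hp => ?_
    rw [Finset.filter_filter, ← hT2 p]
    congr 1
    refine Finset.filter_congr fun r _ => ⟨fun h => h.2, fun h => ⟨h ▸ hp, h⟩⟩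
  have hfibre : ∀ C : Finset P, #{r | φ r ∈ C} = #C + #(P₂ ∩ C) := by
    intro C
    rw [← hfibre1 C, ← hfibre2 C, ← Finset.card_union_of_disjoint, ← Finset.filter_union,
      Finset.sdiff_union_of_subset (Finset.subset_univ T)]
    exact Finset.disjoint_filter_filter Finset.sdiff_disjoint
  refine ⟨φ, fun R₂ hR₂ hdev => ?_⟩
  have hcardT : #R₂ = #T := by
    have h := hfibre2 univ
    simp only [Finset.mem_univ, Finset.filter_true, Finset.inter_univ] at h
    rw [hR₂, h]
  obtain ⟨σ, hσ, hne⟩ := exists_perm_card_ne_le_imbalance J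
    (fun i r => dyadicCell i (x (φ r))) (fun i j r r' hij h => dyadicCell_eq_of_le hij h)
    R₂ T hcardT
  refine (hsub R₂ σ hσ).trans (mul_le_mul_of_nonneg_left ?_ (by positivity))
  have himb : ∀ i ∈ range J,
      (imbalance (fun r => dyadicCell (i + 1) (x (φ r))) R₂ T : ℝ) ≤
        3 * s * √(2 ^ ((i + 1) * k) * Fintype.card P) := by
    intro i hi
    set c : P → Fin k → ℕ := fun p => dyadicCell (i + 1) (x p) with hc
    have hterm : ∀ Q ∈ univ.image c,
        |(#{r ∈ R₂ | c (φ r) = Q} : ℝ) - #{r ∈ T | c (φ r) = Q}| ≤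
          3 * s * √(#{p | c p = Q} : ℝ) := by
      intro Q hQ
      obtain ⟨p, -, rfl⟩ := Finset.mem_image.mp hQ
      have hC : ({q | c q = c p} : Finset P) = cellmates x (i + 1) p := rfl
      have hmem : ∀ r, c (φ r) = c p ↔ φ r ∈ cellmates x (i + 1) p := by
        intro r; simp [cellmates, hc]
      have hR : #{r ∈ R₂ | φ r ∈ cellmates x (i + 1) p} = #(R₂ ∩ univ.filter fun r => φ r ∈ cellmates x (i + 1) p) := by
        congr 1; ext r; simp
      have h1 := hdev i hi p
      rw [hfibre, hcard] at h1
      push_cast at h1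
      simp only [hmem, hR, hfibre2, hC]
      exact abs_sub_le_of_deviations hP (Nat.cast_nonneg _) (Nat.cast_nonneg _)
        (by exact_mod_cast Finset.card_le_card Finset.inter_subset_right) hs h1 (hP₂ i hi p)
    calc (imbalance (fun r => c (φ r)) R₂ T : ℝ)
        = ∑ Q ∈ univ.image fun r => c (φ r),
            |(#{r ∈ R₂ | c (φ r) = Q} : ℝ) - #{r ∈ T | c (φ r) = Q}| := by
          unfold imbalance; push_cast; rfl
      _ ≤ ∑ Q ∈ univ.image c, |(#{r ∈ R₂ | c (φ r) = Q} : ℝ) - #{r ∈ T | c (φ r) = Q}| := by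
          refine Finset.sum_le_sum_of_subset_of_nonneg ?_ fun _ _ _ => abs_nonneg _
          intro Q hQ
          obtain ⟨r, -, rfl⟩ := Finset.mem_image.mp hQ
          exact Finset.mem_image_of_mem c (Finset.mem_univ _)
      _ ≤ ∑ Q ∈ univ.image c, 3 * s * √(#{p | c p = Q} : ℝ) := Finset.sum_le_sum hterm
      _ ≤ 3 * s * √(#(univ.image c) * Fintype.card P) := by
          rw [← Finset.mul_sum]
          exact mul_le_mul_of_nonneg_left (sum_sqrt_card_fiber_le c) (by positivity)
      _ ≤ _ := by
          refine mul_le_mul_of_nonneg_left (Real.sqrt_le_sqrt ?_) (by positivity)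
          refine mul_le_mul_of_nonneg_right ?_ (Nat.cast_nonneg _)
          exact_mod_cast card_image_dyadicCell_le (i + 1) hx
  have hR2 : (Fintype.card R : ℝ) ≤ 2 * Fintype.card P := by
    have := Finset.card_le_univ P₂
    exact_mod_cast (by omega : Fintype.card R ≤ 2 * Fintype.card P)
  calc ∑ r, |S r (φ r) - S r (φ (σ r))|
      ≤ ∑ r, 4 * k * (1 / 2 ^ J + ∑ i ∈ range J, 1 / 2 ^ i *
          if dyadicCell (i + 1) (x (φ r)) ≠ dyadicCell (i + 1) (x (φ (σ r)))
            then (1 : ℝ) else 0) :=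
        Finset.sum_le_sum fun r _ => abs_sub_le_chain hS hx hSx J r _ _
    _ = 4 * k * (Fintype.card R / 2 ^ J + ∑ i ∈ range J, 1 / 2 ^ i *
          (#{r | dyadicCell (i + 1) (x (φ r)) ≠ dyadicCell (i + 1) (x (φ (σ r)))} : ℝ)) := by
        rw [← Finset.mul_sum, Finset.sum_add_distrib, Finset.sum_comm]
        congr 2
        · simp [div_eq_mul_inv]
        · refine Finset.sum_congr rfl fun i _ => ?_
          rw [← Finset.mul_sum, Finset.sum_boole]
    _ ≤ _ := by
        refine mul_le_mul_of_nonneg_left (add_le_add ?_ ?_) (by positivity)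
        · exact div_le_div_of_nonneg_right hR2 (by positivity)
        · refine Finset.sum_le_sum fun i hi => mul_le_mul_of_nonneg_left ?_ (by positivity)
          refine le_trans ?_ (himb i hi)
          exact_mod_cast hne (i + 1) (Finset.mem_range.mp hi)

end Deterministic

/-- Summing the chaining bound over the scales when `2 ^ J` is comparable to `z = n ^ (1 / (d + 2))`:
in dimension at least two the finest scale dominates, up to the number `J` of scales. -/
lemma chain_sum_le {k d J : ℕ} {z s n : ℝ} (hk : k ≤ d + 2) (hz : 1 ≤ z) (hn : n = z ^ (d + 2))
    (hs : 0 ≤ s) (hJ1 : z ≤ 2 ^ J) (hJ2 : (2 : ℝ) ^ J ≤ 2 * z) :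
    1 / n * (4 * k * (2 * n / 2 ^ J + ∑ i ∈ range J, 1 / 2 ^ i *
      (3 * s * √(2 ^ ((i + 1) * k) * n)))) ≤ 4 * k * (2 + 6 * 2 ^ d * (s * J)) / z := by
  have hz0 : 0 < z := by linarith
  have hn0 : 0 < n := by rw [hn]; positivity
  have hterm : ∀ i ∈ range J, 1 / 2 ^ i * (3 * s * √(2 ^ ((i + 1) * k) * n)) ≤
      6 * 2 ^ d * s * z ^ (d + 1) := by
    intro i hi
    have hiJ : i + 1 ≤ J := Finset.mem_range.mp hi
    have h2 : (2 : ℝ) ^ ((i + 1) * k) * n ≤ (2 ^ i * (2 * 2 ^ d * z ^ (d + 1))) ^ 2 := by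
      have h3 : (2 : ℝ) ^ ((i + 1) * k) ≤ 2 ^ ((i + 1) * (d + 2)) :=
        pow_le_pow_right₀ (by norm_num) (Nat.mul_le_mul_left _ hk)
      have h4 : ((2 : ℝ) ^ (i + 1)) ^ d ≤ (2 * z) ^ d :=
        pow_le_pow_left₀ (by positivity)
          ((pow_le_pow_right₀ (by norm_num) hiJ).trans hJ2) _
      calc (2 : ℝ) ^ ((i + 1) * k) * n ≤ 2 ^ ((i + 1) * (d + 2)) * n :=
            mul_le_mul_of_nonneg_right h3 hn0.le
        _ = ((2 : ℝ) ^ (i + 1)) ^ d * ((2 ^ (i + 1)) ^ 2 * z ^ (d + 2)) := by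
            rw [hn, pow_mul, pow_add]; ring
        _ ≤ (2 * z) ^ d * ((2 ^ (i + 1)) ^ 2 * z ^ (d + 2)) :=
            mul_le_mul_of_nonneg_right h4 (by positivity)
        _ = 2 ^ d * ((2 ^ i) ^ 2 * 4 * (z ^ (d + 1)) ^ 2) := by
            rw [mul_pow]; ring
        _ ≤ (2 ^ d) ^ 2 * ((2 ^ i) ^ 2 * 4 * (z ^ (d + 1)) ^ 2) := by
            refine mul_le_mul_of_nonneg_right ?_ (by positivity)
            exact le_self_pow₀ (one_le_pow₀ (by norm_num)) (by norm_num)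
        _ = _ := by ring
    have h5 := Real.sqrt_le_sqrt h2
    rw [Real.sqrt_sq (by positivity)] at h5
    calc 1 / 2 ^ i * (3 * s * √(2 ^ ((i + 1) * k) * n))
        ≤ 1 / 2 ^ i * (3 * s * (2 ^ i * (2 * 2 ^ d * z ^ (d + 1)))) := by gcongr
      _ = _ := by field_simp; ring
  have hsum := Finset.sum_le_card_nsmul (range J) _ _ hterm
  rw [Finset.card_range, nsmul_eq_mul] at hsum
  have hfirst : 2 * n / 2 ^ J ≤ 2 * n / z := div_le_div_of_nonneg_left (by positivity) hz0 hJ1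
  calc _ ≤ 1 / n * (4 * k * (2 * n / z + J * (6 * 2 ^ d * s * z ^ (d + 1)))) := by gcongr
    _ = _ := by
      rw [hn]; field_simp; ring

/-- Conditioning on `P₂`: a failure probability is at most that of `P₂` being bad plus the largest
failure probability over `R₂` for good `P₂`. -/
lemma one_sub_le_randomSplitProb {R P : Type} [Fintype R] [Fintype P] [DecidableEq R]
    [DecidableEq P] {m : ℕ} (hR : m ≤ Fintype.card R) (hP : m ≤ Fintype.card P)
    (E : Finset R → Finset P → Prop) (G : Finset P → Prop) {ε₁ ε₂ : ℝ} (h₂ : 0 ≤ ε₂)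
    (hG : ∃ B ⊆ (univ : Finset P).powersetCard m, (#B : ℝ) ≤ ε₁ * (Fintype.card P).choose m ∧
      ∀ P₂ ∈ (univ : Finset P).powersetCard m, P₂ ∉ B → G P₂)
    (hE : ∀ P₂ ∈ (univ : Finset P).powersetCard m, G P₂ →
      ∃ B ⊆ (univ : Finset R).powersetCard m, (#B : ℝ) ≤ ε₂ * (Fintype.card R).choose m ∧
        ∀ R₂ ∈ (univ : Finset R).powersetCard m, R₂ ∉ B → E R₂ P₂) :
    1 - (ε₁ + ε₂) ≤ randomSplitProb R P m E := by
  classical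
  set U := (univ : Finset R).powersetCard m with hU
  set W := (univ : Finset P).powersetCard m with hW
  have hUc : #U = (Fintype.card R).choose m := by rw [hU, Finset.card_powersetCard, Finset.card_univ]
  have hWc : #W = (Fintype.card P).choose m := by rw [hW, Finset.card_powersetCard, Finset.card_univ]
  have hU0 : (0 : ℝ) < #U := by rw [hUc]; exact_mod_cast Nat.choose_pos hR
  have hW0 : (0 : ℝ) < #W := by rw [hWc]; exact_mod_cast Nat.choose_pos hP
  obtain ⟨B, hBsub, hB, hBG⟩ := hG
  rw [← hWc] at hB
  rw [← hUc] at hE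
  have hbad : (#{y ∈ U ×ˢ W | ¬ E y.1 y.2} : ℝ) ≤ (ε₁ + ε₂) * (#U * #W) := by
    have h1 : (#{y ∈ U ×ˢ W | ¬ E y.1 y.2} : ℝ) = ∑ P₂ ∈ W, (#{R₂ ∈ U | ¬ E R₂ P₂} : ℝ) := by
      rw [Finset.card_filter, Finset.sum_product_right]
      push_cast
      refine Finset.sum_congr rfl fun P₂ _ => ?_
      rw [Finset.card_filter]; push_cast; rfl
    rw [h1]
    calc _ ≤ ∑ P₂ ∈ W, ((if P₂ ∈ B then (#U : ℝ) else 0) + ε₂ * #U) := by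
          refine Finset.sum_le_sum fun P₂ hP₂ => ?_
          by_cases hb : P₂ ∈ B
          · rw [if_pos hb]
            have : (#{R₂ ∈ U | ¬ E R₂ P₂} : ℝ) ≤ #U := by
              exact_mod_cast Finset.card_filter_le _ _
            have := mul_nonneg h₂ hU0.le
            linarith
          · rw [if_neg hb, zero_add]
            obtain ⟨B', -, hB', hB'E⟩ := hE P₂ hP₂ (hBG P₂ hP₂ hb)
            refine le_trans ?_ hB'
            exact_mod_cast Finset.card_le_card fun R₂ hR₂ => by
              rw [Finset.mem_filter] at hR₂
              by_contra hcon
              exact hR₂.2 (hB'E R₂ hR₂.1 hcon)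
      _ = #B * #U + #W * (ε₂ * #U) := by
          rw [Finset.sum_add_distrib, ← Finset.sum_filter, Finset.filter_mem_eq_inter,
            Finset.inter_eq_right.mpr hBsub]
          simp
      _ ≤ ε₁ * #W * #U + #W * (ε₂ * #U) := by gcongr
      _ = _ := by ring
  have htot := Finset.card_filter_add_card_filter_not (s := U ×ˢ W) (fun y => E y.1 y.2)
  have htot' : (#{y ∈ U ×ˢ W | E y.1 y.2} : ℝ) + #{y ∈ U ×ˢ W | ¬ E y.1 y.2} = #U * #W := by
    rw [← Nat.cast_mul, ← Finset.card_product]; exact_mod_cast htot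
  have hprob : randomSplitProb R P m E = (#{y ∈ U ×ˢ W | E y.1 y.2} : ℝ) / (#U * #W) := by
    unfold randomSplitProb
    rw [← hU, ← hW, Finset.card_product, Nat.cast_mul]
  rw [hprob, le_div_iff₀ (by positivity)]
  linarith

/-- Union bound for the concentration of `|X ∩ Q|` over a finite family of sets `Q`. -/
lemma exists_exceptional_sets {α ι : Type} [Fintype α] [DecidableEq α] {m : ℕ}
    (hm : m ≤ Fintype.card α) (hN : 0 < Fintype.card α) (I : Finset ι) (Q : ι → Finset α) (s : ℝ) :
    ∃ B ⊆ (univ : Finset α).powersetCard m,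
      (#B : ℝ) ≤ #I * (6 * ((Fintype.card α : ℝ) + 1) * Real.exp (-s)) *
        (Fintype.card α).choose m ∧
      ∀ X ∈ (univ : Finset α).powersetCard m, X ∉ B → ∀ a ∈ I,
        |(#(X ∩ Q a) : ℝ) - #(Q a) * (m / Fintype.card α)| ≤ s * √(#(Q a)) := by
  classical
  refine ⟨I.biUnion fun a => {X ∈ (univ : Finset α).powersetCard m |
        s * √(#(Q a)) < |(#(X ∩ Q a) : ℝ) - #(Q a) * (m / Fintype.card α)|}, ?_, ?_, ?_⟩
  · exact Finset.biUnion_subset.mpr fun a _ => Finset.filter_subset _ _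
  · calc _ ≤ ∑ a ∈ I, (#{X ∈ (univ : Finset α).powersetCard m |
        s * √(#(Q a)) < |(#(X ∩ Q a) : ℝ) - #(Q a) * (m / Fintype.card α)|} : ℝ) := by
          exact_mod_cast Finset.card_biUnion_le
      _ ≤ ∑ _a ∈ I, _ := Finset.sum_le_sum fun a _ => card_powersetCard_deviation_le hm hN (Q a) s
      _ = _ := by rw [Finset.sum_const, nsmul_eq_mul]; ring
  · intro X hX hXB a ha
    by_contra hcon
    exact hXB (Finset.mem_biUnion.mpr ⟨a, ha, Finset.mem_filter.mpr ⟨hX, not_le.mp hcon⟩⟩)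

/-! ### The probabilistic bound -/

/-- The random split loses at most `O(log² n · n ^ (-1 / (d + 2)))` for a matrix of rank at most
`d + 2`, with an explicit constant. The exponent `d + 2 ≥ 2` reflects that below dimension two the
sampling error `n ^ (-1 / 2)` takes over. -/
lemma one_sub_inv_le_randomSplitProb {k d n m : ℕ} (hk : k ≤ d + 2) (hn : 6 ≤ n) (hmn : m ≤ n)
    {S : Matrix (Fin (n + m)) (Fin n) ℝ} (hS : ∀ r p, 0 ≤ S r p ∧ S r p ≤ 1) (hrank : S.rank = k) :
    1 - 1 / (n : ℝ) ≤ randomSplitProb (Fin (n + m)) (Fin n) m (fun R₂ P₂ =>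
      suboptimality S R₂ P₂ ≤ 4 * k * (2 + 36 * 2 ^ d) * Real.logb 2 n ^ 2 *
        (n : ℝ) ^ (-(1 / ((d : ℝ) + 2)))) := by
  have hn6 : (6 : ℝ) ≤ n := by exact_mod_cast hn
  have hn0 : (0 : ℝ) < n := by linarith
  have : Nonempty (Fin n) := ⟨⟨0, by omega⟩⟩
  set L := Real.logb 2 (n : ℝ) with hL
  have hL2 : 2 ≤ L := by
    rw [hL, Real.le_logb_iff_rpow_le (by norm_num) hn0]
    norm_num; linarith
  have hLn : L ≤ n := by
    rw [hL, Real.logb_le_iff_le_rpow (by norm_num) hn0, Real.rpow_natCast]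
    exact_mod_cast Nat.lt_two_pow_self.le
  have hlog : Real.log n ≤ L := by
    have h0 : 0 ≤ Real.log n := Real.log_nonneg (by linarith)
    rw [hL, Real.logb, le_div_iff₀ (Real.log_pos (by norm_num))]
    have := Real.log_two_lt_d9
    nlinarith
  set D : ℝ := (d : ℝ) + 2 with hD
  have hD2 : 2 ≤ D := by rw [hD]; linarith [(Nat.cast_nonneg d : (0 : ℝ) ≤ d)]
  -- the finest scale `2⁻ᴶ` is about `n ^ (-1 / (d + 2))`
  set z : ℝ := (n : ℝ) ^ (1 / D) with hz
  have hzn : (n : ℝ) = z ^ (d + 2) := by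
    rw [hz, ← Real.rpow_mul_natCast hn0.le]
    push_cast
    rw [one_div, inv_mul_cancel₀ (by positivity), Real.rpow_one]
  have hz1 : 1 ≤ z := Real.one_le_rpow (by linarith) (by positivity)
  have hzL : z = (2 : ℝ) ^ (L / D) := by
    rw [div_eq_mul_one_div, Real.rpow_mul (by norm_num), hL,
      Real.rpow_logb (by norm_num) (by norm_num) hn0]
  set J : ℕ := ⌈L / D⌉₊ with hJ
  have hJ1 : L / D ≤ J := Nat.le_ceil _
  have hJ2 : (J : ℝ) ≤ L / D + 1 := (Nat.ceil_lt_add_one (by positivity)).le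
  have hJL : (J : ℝ) ≤ L := by
    have : L / D ≤ L / 2 := div_le_div_of_nonneg_left (by linarith) (by norm_num) hD2
    linarith
  have hzJ1 : z ≤ 2 ^ J := by
    rw [hzL, ← Real.rpow_natCast]
    exact Real.rpow_le_rpow_of_exponent_le (by norm_num) hJ1
  have hzJ2 : (2 : ℝ) ^ J ≤ 2 * z := by
    rw [hzL, ← Real.rpow_natCast]
    refine (Real.rpow_le_rpow_of_exponent_le (by norm_num) hJ2).trans (le_of_eq ?_)
    rw [Real.rpow_add (by norm_num), Real.rpow_one, mul_comm]
  obtain ⟨e, x, hx, hSx⟩ := exists_column_coordinates S hrank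
  -- deviations of `6 log₂ n` standard units have probability below `n ^ (-6)`, up to the factor
  -- `6 (N + 1)` of the concentration bound
  set s : ℝ := 6 * L with hs
  have hs0 : 0 ≤ s := by positivity
  have hexp : Real.exp (-s) ≤ 1 / (n : ℝ) ^ 6 := by
    rw [Real.exp_neg, ← one_div]
    refine one_div_le_one_div_of_le (by positivity) ?_
    rw [← Real.exp_log hn0, ← Real.exp_nat_mul, hs]
    refine Real.exp_le_exp.mpr ?_
    push_cast
    linarith
  set I := range J ×ˢ (univ : Finset (Fin n)) with hI
  have hIc : (#I : ℝ) = J * n := by rw [hI, Finset.card_product]; simp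
  set ε₁ : ℝ := #I * (6 * ((n : ℝ) + 1) * Real.exp (-s)) with hε₁
  set ε₂ : ℝ := #I * (6 * ((n : ℝ) + m + 1) * Real.exp (-s)) with hε₂
  have hε : ε₁ + ε₂ ≤ 1 / n := by
    have hm : (m : ℝ) ≤ n := by exact_mod_cast hmn
    calc ε₁ + ε₂ = J * (n * (6 * (2 * n + m + 2))) * Real.exp (-s) := by
          rw [hε₁, hε₂, hIc]; ring
      _ ≤ n * (n * (6 * (4 * n))) * (1 / (n : ℝ) ^ 6) := by
          have : (J : ℝ) ≤ n := hJL.trans hLn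
          gcongr
          linarith
      _ = 24 / (n : ℝ) ^ 3 := by field_simp; norm_num
      _ ≤ 1 / n := by
          rw [div_le_div_iff₀ (by positivity) hn0]
          nlinarith [mul_le_mul hn6 hn6 (by norm_num) hn0.le]
  refine (sub_le_sub_left hε 1).trans ?_
  refine one_sub_le_randomSplitProb (by simp) (by simpa using hmn) _
    (fun P₂ => ∀ i ∈ range J, ∀ p, |(#(P₂ ∩ cellmates x (i + 1) p) : ℝ) -
      #(cellmates x (i + 1) p) * ((m : ℝ) / n)| ≤ s * √(#(cellmates x (i + 1) p)))
    (mul_nonneg (Nat.cast_nonneg _) (by positivity)) ?_ ?_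
  · obtain ⟨B, hB, hBc, hBg⟩ := exists_exceptional_sets (α := Fin n) (m := m)
      (by simpa using hmn) (by simp; omega) I (fun a => cellmates x (a.1 + 1) a.2) s
    rw [Fintype.card_fin] at hBc
    refine ⟨B, hB, by rwa [Fintype.card_fin], fun P₂ hP₂ hPB i hi p => ?_⟩
    simpa using hBg P₂ hP₂ hPB (i, p) (Finset.mem_product.mpr ⟨hi, Finset.mem_univ p⟩)
  · intro P₂ hP₂ hgood
    have hc : #P₂ = m := (Finset.mem_powersetCard.mp hP₂).2
    obtain ⟨φ, hφ⟩ := exists_oracle_suboptimality_le hS hx hSx (P₂ := P₂) (by simp [hc]) J hs0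
      (by simpa [hc] using hgood)
    obtain ⟨B, hB, hBc, hBg⟩ := exists_exceptional_sets (α := Fin (n + m)) (m := m)
      (by simp) (by simp; omega) I
      (fun a => univ.filter fun r => φ r ∈ cellmates x (a.1 + 1) a.2) s
    rw [Fintype.card_fin, Nat.cast_add] at hBc
    refine ⟨B, hB, by rwa [Fintype.card_fin], fun R₂ hR₂ hRB => ?_⟩
    have hcR : #R₂ = m := (Finset.mem_powersetCard.mp hR₂).2
    refine (hφ R₂ (hcR.trans hc.symm) fun i hi p => ?_).trans ?_
    · have := hBg R₂ hR₂ hRB (i, p) (Finset.mem_product.mpr ⟨hi, Finset.mem_univ p⟩)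
      rw [hc]; exact this
    · rw [Fintype.card_fin]
      refine (chain_sum_le hk hz1 hzn hs0 hzJ1 hzJ2).trans ?_
      rw [Real.rpow_neg hn0.le, ← hz, ← div_eq_mul_inv]
      refine div_le_div_of_nonneg_right ?_ (by linarith)
      rw [mul_assoc (4 * (k : ℝ))]
      refine mul_le_mul_of_nonneg_left ?_ (by positivity)
      have h1 : s * J ≤ 6 * L ^ 2 := by
        rw [hs]; nlinarith
      have h2 : (0 : ℝ) < 2 ^ d := by positivity
      nlinarith [mul_le_mul_of_nonneg_left h1 h2.le]

lemma randomSplitProb_mono {R P : Type} [Fintype R] [Fintype P] {m : ℕ}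
    {E F : Finset R → Finset P → Prop} (h : ∀ R₂ P₂, E R₂ P₂ → F R₂ P₂) :
    randomSplitProb R P m E ≤ randomSplitProb R P m F := by
  classical
  unfold randomSplitProb
  refine div_le_div_of_nonneg_right ?_ (Nat.cast_nonneg _)
  refine Nat.cast_le.mpr (Finset.card_le_card fun y hy => ?_)
  rw [Finset.mem_filter] at hy ⊢
  exact ⟨hy.1, h _ _ hy.2⟩

end TwoStage


theorem theorem3 (k : ℕ) (hk : 1 ≤ k) :
    ∃ C η : ℝ, ∀ β : ℝ, 0 ≤ β → β ≤ 1 → ∃ n₀ : ℕ, ∀ n : ℕ, n₀ ≤ n →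
      ∀ m : ℕ, β * (n : ℝ) = (m : ℝ) →
      ∀ S : Matrix (Fin (n + m)) (Fin n) ℝ, (∀ r p, 0 ≤ S r p ∧ S r p ≤ 1) → S.rank = k →
        (k = 1 →
          1 - 1 / (n : ℝ) ≤ TwoStage.randomSplitProb (Fin (n + m)) (Fin n) m (fun R₂ P₂ =>
            TwoStage.suboptimality S R₂ P₂ ≤
              C * (Real.logb 2 (n : ℝ)) ^ η * (n : ℝ) ^ (-(1 / 2) : ℝ))) ∧
        (k = 2 →
          1 - 1 / (n : ℝ) ≤ TwoStage.randomSplitProb (Fin (n + m)) (Fin n) m (fun R₂ P₂ =>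
            TwoStage.suboptimality S R₂ P₂ ≤
              C * (Real.logb 2 (n : ℝ)) ^ η *
                (n : ℝ) ^ (-(1 / 2) + 1 / Real.logb 2 (Real.logb 2 (n : ℝ)) : ℝ))) ∧
        (3 ≤ k →
          1 - 1 / (n : ℝ) ≤ TwoStage.randomSplitProb (Fin (n + m)) (Fin n) m (fun R₂ P₂ =>
            TwoStage.suboptimality S R₂ P₂ ≤
              C * (Real.logb 2 (n : ℝ)) ^ η *
                (n : ℝ) ^ (-(1 / (k : ℝ)) + 1 / Real.logb 2 (Real.logb 2 (n : ℝ)) : ℝ))) := by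
  -- `k - 2` is truncated: ranks one and two are both treated in dimension two
  refine ⟨4 * k * (2 + 36 * 2 ^ (k - 2)), 2, fun β _ hβ => ⟨6, fun n hn m hm S hS hrank => ?_⟩⟩
  have hn0 : (1 : ℝ) ≤ n := by exact_mod_cast (by omega : 1 ≤ n)
  have hmn : m ≤ n := by
    have : (m : ℝ) ≤ n := by rw [← hm]; nlinarith
    exact_mod_cast this
  have main := TwoStage.one_sub_inv_le_randomSplitProb (d := k - 2) (by omega) hn hmn hS hrank
  have hloglog : 0 ≤ 1 / Real.logb 2 (Real.logb 2 (n : ℝ)) := by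
    refine one_div_nonneg.mpr (Real.logb_nonneg (by norm_num) ?_)
    rw [Real.le_logb_iff_rpow_le (by norm_num) (by linarith), Real.rpow_one]
    exact_mod_cast (by omega : 2 ≤ n)
  have weaken : ∀ a : ℝ, -(1 / (((k - 2 : ℕ) : ℝ) + 2)) ≤ a →
      1 - 1 / (n : ℝ) ≤ TwoStage.randomSplitProb (Fin (n + m)) (Fin n) m (fun R₂ P₂ =>
        TwoStage.suboptimality S R₂ P₂ ≤ 4 * k * (2 + 36 * 2 ^ (k - 2)) *
          (Real.logb 2 (n : ℝ)) ^ (2 : ℝ) * (n : ℝ) ^ a) := by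
    intro a ha
    refine main.trans (TwoStage.randomSplitProb_mono fun R₂ P₂ h => h.trans ?_)
    rw [Real.rpow_two]
    exact mul_le_mul_of_nonneg_left (Real.rpow_le_rpow_of_exponent_le hn0 ha) (by positivity)
  refine ⟨fun h => ?_, fun h => ?_, fun h => ?_⟩
  · refine weaken _ ?_
    simp [h]
  · refine weaken _ ?_
    simpa [h] using hloglog
  · refine weaken _ ?_
    have : ((k - 2 : ℕ) : ℝ) + 2 = k := by
      exact_mod_cast (by omega : k - 2 + 2 = k)
    rw [this]
    linarith
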